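/- **Conventions.** A compact quantum group is a pair $\mathbb{H}=(C(\mathbb{H}),\Delta)$, where $C(\mathbb{H})$ is a unital $C^*$-algebra and $\Delta\colon C(\mathbb{H})\to C(\mathbb{H})\otimes_{\min}C(\mathbb{H})$ is a unital $*$-homomorphism with $(\Delta\otimes\mathrm{id})\Delta=(\mathrm{id}\otimes\Delta)\Delta$ such that the linear spans of $(C(\mathbb{H})\otimes 1)\Delta(C(\mathbb{H}))$ and $(1\otimes C(\mathbb{H}))\Delta(C(\mathbb{H}))$ are dense; it is of Kac type if its Haar state is a trace. All representations are finite dimensional and unitary. $\operatorname{Irr}(\mathbb{H})$ is the set of equivalence classes of irreducible representations, and for every $x\in\operatorname{Irr}(\mathbb{H})$ a representation $u^x\in B(H_x)\otimes C(\mathbb{H})$ in the class $x$ is chosen and fixed; $\dim x=\dim H_x$. Let $c_c(\widehat{\mathbb{H}})=\bigoplus_{x}B(H_x)$ (algebraic direct sum), let $p_x$ be the central projection onto the block $B(H_x)$, and for $a=(a_x)_x\in c_c(\widehat{\mathbb{H}})$ put $$\mathcal{F}(a)=\sum_{x}(\dim x)\,(\operatorname{Tr}_{H_x}\otimes\mathrm{id})\bigl(u^x(a_x\otimes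 1)\bigr)\in C(\mathbb{H}),\qquad \|a\|_0^2=\sum_{x}(\dim x)\operatorname{Tr}_{H_x}(a_x^*a_x).$$ A length function on $\widehat{\mathbb{H}}$ is a map $l\colon\operatorname{Irr}(\mathbb{H})\to\mathbb{R}_{\ge 0}$ with $l(\varepsilon)=0$ for the trivial representation $\varepsilon$, $l(\overline{x})=l(x)$ for all $x$, and $l(z)\le l(x)+l(y)$ whenever $z\subseteq x\otimes y$. For $k\in\mathbb{N}=\{0,1,2,\dots\}$ let $Q_{l,k}=\sum_{x:\,l(x)<k+1}p_x$. For a length function $l$ and $P\in\mathbb{R}[X]$ we say that $(l,P)$ satisfies (RD) if $$\forall k\in\mathbb{N},\ \forall a\in Q_{l,k}\,c_c(\widehat{\mathbb{H}}):\quad \|\mathcal{F}(a)\|_{C(\mathbb{H})}\le P(k)\,\|a\|_0 .$$ An automorphism $\theta$ of $\mathbb{H}$ is a $*$-automorphism of $C(\mathbb{H})$ with $\Delta\theta=(\theta\otimes\theta)\Delta$; it acts on $\operatorname{Irr}(\mathbb{H})$ by $\theta_*[u]=[(\mathrm{id}\otimes\theta)(u)]$. For a group $\Theta$ of automorphisms,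 $l$ is $\Theta$-invariant if $l\circ\theta_*=l$ for all $\theta\in\Theta$. **Proposition.** Let $\mathbb{H}=(C(\mathbb{H}),\Delta)$ be a compact quantum group of Kac type and $\Theta$ a finite subgroup of $\operatorname{Aut}(C(\mathbb{H}),\Delta)$. The following are equivalent. 1. There exist a length function $l$ on $\widehat{\mathbb{H}}$ and $P\in\mathbb{R}[X]$ such that $(l,P)$ satisfies (RD). 2. There exist a $\Theta$-invariant length function $l_\Theta$ on $\widehat{\mathbb{H}}$ and $Q\in\mathbb{R}[X]$ such that $(l_\Theta,Q)$ satisfies (RD). More precisely, if $l$ is a length function and $(l,P)$ satisfies (RD), then $$l_\Theta=\frac{1}{|\Theta|}\sum_{\theta\in\Theta}l\circ\theta_*$$ is a $\Theta$-invariant length function and $(l_\Theta,\sqrt{|\Theta|}\,P)$ satisfies (RD). -/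

import Mathlib

noncomputable section

open scoped TensorProduct ENNReal ComplexOrder

/-- The states of a unital C⋆-algebra: positive linear functionals `φ` with `φ 1 = 1`
(positivity refers to the order whose positive elements are the `star a * a`). -/
def CStarState (A : Type*) [CStarAlgebra A] : Type _ :=
  letI := CStarAlgebra.spectralOrder A
  {φ : A →ₚ[ℂ] ℂ // φ 1 = 1}

namespace CStarState

variable {A : Type*} [CStarAlgebra A]

/-- The underlying positive functional. -/
def toPos (φ : CStarState A) :
    letI := CStarAlgebra.spectralOrder A
    A →ₚ[ℂ] ℂ := φ.1

/-- The GNS Hilbert space of a state. -/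
def Space (φ : CStarState A) : Type _ :=
  letI := CStarAlgebra.spectralOrder A
  letI := CStarAlgebra.spectralOrderedRing A
  φ.toPos.GNS

variable (φ : CStarState A)

instance : NormedAddCommGroup φ.Space :=
  letI := CStarAlgebra.spectralOrder A
  letI := CStarAlgebra.spectralOrderedRing A
  inferInstanceAs (NormedAddCommGroup φ.toPos.GNS)

instance : InnerProductSpace ℂ φ.Space :=
  letI := CStarAlgebra.spectralOrder A
  letI := CStarAlgebra.spectralOrderedRing A
  inferInstanceAs (InnerProductSpace ℂ φ.toPos.GNS)

instance : CompleteSpace φ.Space :=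
  letI := CStarAlgebra.spectralOrder A
  letI := CStarAlgebra.spectralOrderedRing A
  inferInstanceAs (CompleteSpace φ.toPos.GNS)

/-- The GNS representation of a state. -/
def rep : A →⋆ₐ[ℂ] (φ.Space →L[ℂ] φ.Space) :=
  letI := CStarAlgebra.spectralOrder A
  letI := CStarAlgebra.spectralOrderedRing A
  φ.toPos.gnsStarAlgHom

instance : Nontrivial φ.Space := by
  let _ := CStarAlgebra.spectralOrder A
  let _ := CStarAlgebra.spectralOrderedRing A
  refine ⟨⟨((φ.toPos.toPreGNS 1 : φ.toPos.PreGNS) : φ.toPos.GNS), (0 : φ.toPos.GNS), fun h => ?_⟩⟩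
  have h1 : ‖((φ.toPos.toPreGNS 1 : φ.toPos.PreGNS) : φ.toPos.GNS)‖ = 0 := by rw [h]; exact norm_zero
  rw [UniformSpace.Completion.norm_coe, PositiveLinearMap.preGNS_norm_def] at h1
  have h2 : φ.toPos 1 = 1 := φ.2
  simp [h2] at h1

end CStarState

/-- The `ℓ^∞`-product of a family of nonzero unital C⋆-algebras. -/
abbrev lpInftyCStarAlgebra {I : Type*} (E : I → Type*) [∀ i, CStarAlgebra (E i)]
    [∀ i, Nontrivial (E i)] : CStarAlgebra (lp E ∞) where

/-- The closed unital ⋆-subalgebra generated by a subset of a unital C⋆-algebra. -/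
def closedAdjoin {R : Type*} [CStarAlgebra R] (s : Set R) : StarSubalgebra ℂ R :=
  (StarAlgebra.adjoin ℂ s).topologicalClosure

lemma mem_closedAdjoin {R : Type*} [CStarAlgebra R] {s : Set R} {x : R} (hx : x ∈ s) :
    x ∈ closedAdjoin s :=
  StarSubalgebra.le_topologicalClosure _ (StarAlgebra.subset_adjoin ℂ _ hx)

instance closedAdjoinCStarAlgebra {R : Type*} [CStarAlgebra R] (s : Set R) :
    CStarAlgebra (closedAdjoin s) :=
  haveI : IsClosed (closedAdjoin s : Set R) := StarSubalgebra.isClosed_topologicalClosure _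
  StarSubalgebra.cstarAlgebra (closedAdjoin s)

namespace MinTensor

variable {A B : Type*} [CStarAlgebra A] [CStarAlgebra B]

/-- The Hilbert space tensor product of two GNS spaces. -/
abbrev PairSpace (p : CStarState A × CStarState B) : Type _ :=
  UniformSpace.Completion (p.1.Space ⊗[ℂ] p.2.Space)

instance (p : CStarState A × CStarState B) : Nontrivial (PairSpace p) := by
  obtain ⟨x, hx⟩ := exists_ne (0 : p.1.Space)
  obtain ⟨y, hy⟩ := exists_ne (0 : p.2.Space)
  refine ⟨⟨((x ⊗ₜ[ℂ] y : p.1.Space ⊗[ℂ] p.2.Space) : PairSpace p), 0, fun h => ?_⟩⟩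
  have h1 := congrArg norm h
  rw [UniformSpace.Completion.norm_coe, TensorProduct.norm_tmul] at h1
  simp [hx, hy] at h1

/-- The operator `π_φ(a) ⊗ π_ψ(b)`. -/
def pairOp (p : CStarState A × CStarState B) (a : A) (b : B) : PairSpace p →L[ℂ] PairSpace p :=
  (TensorProduct.mapL (p.1.rep a) (p.2.rep b)).completion

variable (A B) in
/-- The `ℓ^∞`-product of the algebras `B(H_φ ⊗ H_ψ)` over all pairs of states. -/
def Ambient : Type _ :=
  lp (fun p : CStarState A × CStarState B => PairSpace p →L[ℂ] PairSpace p) ∞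

instance ambientCStarAlgebra : CStarAlgebra (Ambient A B) :=
  lpInftyCStarAlgebra fun p : CStarState A × CStarState B => PairSpace p →L[ℂ] PairSpace p

lemma norm_pairOp_le (p : CStarState A × CStarState B) (a : A) (b : B) :
    ‖pairOp p a b‖ ≤ ‖a‖ * ‖b‖ := by
  refine ContinuousLinearMap.opNorm_le_bound _ (by positivity) fun x => ?_
  induction x using UniformSpace.Completion.induction_on with
  | hp => exact isClosed_le (by fun_prop) (by fun_prop)
  | ih x =>
    rw [pairOp, ContinuousLinearMap.completion_apply_coe, UniformSpace.Completion.norm_coe,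
      UniformSpace.Completion.norm_coe]
    refine (ContinuousLinearMap.le_opNorm _ _).trans ?_
    gcongr
    refine (TensorProduct.norm_mapL_le _ _).trans ?_
    gcongr
    · exact NonUnitalStarAlgHom.norm_apply_le p.1.rep a
    · exact NonUnitalStarAlgHom.norm_apply_le p.2.rep b

/-- The family `(π_φ(a) ⊗ π_ψ(b))` over all pairs of states. -/
def ambientTmul (a : A) (b : B) : Ambient A B :=
  show lp (fun p : CStarState A × CStarState B => PairSpace p →L[ℂ] PairSpace p) ∞ from
  ⟨fun p => pairOp p a b, memℓp_infty ⟨‖a‖ * ‖b‖, by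
    rintro _ ⟨p, rfl⟩
    exact norm_pairOp_le p a b⟩⟩

lemma ambientTmul_one : ambientTmul (1 : A) (1 : B) = 1 := by
  refine lp.ext (funext fun p => ?_)
  change pairOp p 1 1 = 1
  ext x
  induction x using UniformSpace.Completion.induction_on with
  | hp => exact isClosed_eq (by fun_prop) (by fun_prop)
  | ih x =>
    rw [pairOp, ContinuousLinearMap.completion_apply_coe, map_one, map_one]
    change ((TensorProduct.mapL (.id ℂ _) (.id ℂ _) x : _) : PairSpace p) = _
    rw [TensorProduct.mapL_id_id]
    rfl

end MinTensor

/-- The minimal (spatial) tensor product of two unital C⋆-algebras: the closed ⋆-subalgebra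
generated by the elementary tensors `a ⊗ b = (π_φ(a) ⊗ π_ψ(b))`, where `φ`, `ψ` run through all
states, that is, the closure of the algebraic tensor product in the tensor product of the
universal (hence faithful) representations. -/
def MinTensor (A B : Type*) [CStarAlgebra A] [CStarAlgebra B] : Type _ :=
  closedAdjoin (Set.range fun q : A × B => MinTensor.ambientTmul q.1 q.2)

namespace MinTensor

variable {A B : Type*} [CStarAlgebra A] [CStarAlgebra B]

instance : CStarAlgebra (MinTensor A B) :=
  closedAdjoinCStarAlgebra (Set.range fun q : A × B => ambientTmul q.1 q.2)

/-- The elementary tensor `a ⊗ b`. -/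
def tmul (a : A) (b : B) : MinTensor A B :=
  ⟨ambientTmul a b, mem_closedAdjoin ⟨(a, b), rfl⟩⟩

lemma tmul_one : tmul (1 : A) (1 : B) = 1 := Subtype.ext ambientTmul_one

end MinTensor

/-- `D` is the tensor product `f ⊗ g` of two ⋆-homomorphisms, i.e. the (unique) ⋆-homomorphism
of the minimal tensor products with `a ⊗ b ↦ f a ⊗ g b`. -/
def IsTensorMap {A B A' B' : Type*} [CStarAlgebra A] [CStarAlgebra B] [CStarAlgebra A']
    [CStarAlgebra B'] (f : A →⋆ₐ[ℂ] A') (g : B →⋆ₐ[ℂ] B')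
    (D : MinTensor A B →⋆ₐ[ℂ] MinTensor A' B') : Prop :=
  ∀ a b, D (MinTensor.tmul a b) = MinTensor.tmul (f a) (g b)

/-- Coassociativity `(Δ ⊗ id)Δ = (id ⊗ Δ)Δ`; `α` is the canonical identification
`(A ⊗ A) ⊗ A = A ⊗ (A ⊗ A)`. -/
def IsCoassociative {A : Type*} [CStarAlgebra A] (Δ : A →⋆ₐ[ℂ] MinTensor A A) : Prop :=
  ∃ (D₁ : MinTensor A A →⋆ₐ[ℂ] MinTensor (MinTensor A A) A)
    (D₂ : MinTensor A A →⋆ₐ[ℂ] MinTensor A (MinTensor A A))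
    (α : MinTensor (MinTensor A A) A ≃⋆ₐ[ℂ] MinTensor A (MinTensor A A)),
    IsTensorMap Δ (StarAlgHom.id ℂ A) D₁ ∧ IsTensorMap (StarAlgHom.id ℂ A) Δ D₂ ∧
    (∀ a b c, α (MinTensor.tmul (MinTensor.tmul a b) c) =
      MinTensor.tmul a (MinTensor.tmul b c)) ∧
    ∀ a, α (D₁ (Δ a)) = D₂ (Δ a)

/-- A compact quantum group `ℍ = (C(ℍ), Δ)` in the sense of Woronowicz, with `A = C(ℍ)`. -/
structure CompactQuantumGroup (A : Type*) [CStarAlgebra A] where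
  /-- The comultiplication, a unital ⋆-homomorphism into the minimal tensor product. -/
  comul : A →⋆ₐ[ℂ] MinTensor A A
  coassoc : IsCoassociative comul
  dense_left : Dense (Submodule.span ℂ
    {t | ∃ a b, t = MinTensor.tmul a 1 * comul b} : Set (MinTensor A A))
  dense_right : Dense (Submodule.span ℂ
    {t | ∃ a b, t = MinTensor.tmul 1 a * comul b} : Set (MinTensor A A))

namespace CompactQuantumGroup

variable {A : Type*} [CStarAlgebra A] (H : CompactQuantumGroup A)

/-- `h` is the Haar state: a state with `(h ⊗ id)Δ(a) = h(a)1 = (id ⊗ h)Δ(a)`. The maps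
`E₁ = h ⊗ id` and `E₂ = id ⊗ h` are the (unique) continuous extensions of the slice maps. -/
def IsHaarState (h : A →ₗ[ℂ] ℂ) : Prop :=
  h 1 = 1 ∧ (∀ a, 0 ≤ h (star a * a)) ∧
  ∃ E₁ E₂ : MinTensor A A →L[ℂ] A,
    (∀ a b, E₁ (MinTensor.tmul a b) = h a • b) ∧
    (∀ a b, E₂ (MinTensor.tmul a b) = h b • a) ∧
    ∀ a, E₁ (H.comul a) = h a • 1 ∧ E₂ (H.comul a) = h a • 1

/-- Kac type: the Haar state is a trace. -/
def IsKac : Prop :=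
  ∃ h : A →ₗ[ℂ] ℂ, H.IsHaarState h ∧ ∀ a b, h (a * b) = h (b * a)

/-- A finite dimensional unitary representation, written as the matrix `u = (u i j)` of its
coefficients in an orthonormal basis: `u` is unitary and `Δ(u i j) = ∑ k, u i k ⊗ u k j`. -/
def IsUnitaryRep {ι : Type*} [Fintype ι] [DecidableEq ι] (u : Matrix ι ι A) : Prop :=
  u ∈ unitary (Matrix ι ι A) ∧
    ∀ i j, H.comul (u i j) = ∑ k, MinTensor.tmul (u i k) (u k j)

end CompactQuantumGroup

/-- The scalar matrix `T`, seen as the matrix `T ⊗ 1` over `A`. -/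
abbrev scalarMatrix (A : Type*) [CStarAlgebra A] {ι κ : Type*} (T : Matrix κ ι ℂ) :
    Matrix κ ι A :=
  T.map (algebraMap ℂ A)

/-- `T` intertwines `u` and `v`: `(T ⊗ 1) u = v (T ⊗ 1)`. -/
def IsIntertwiner {A : Type*} [CStarAlgebra A] {ι κ : Type*} [Fintype ι] [Fintype κ]
    (u : Matrix ι ι A) (v : Matrix κ κ A) (T : Matrix κ ι ℂ) : Prop :=
  scalarMatrix A T * u = v * scalarMatrix A T

namespace CompactQuantumGroup

variable {A : Type*} [CStarAlgebra A] (H : CompactQuantumGroup A)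

/-- An irreducible finite dimensional unitary representation. -/
structure IrrRep where
  dim : ℕ
  mat : Matrix (Fin dim) (Fin dim) A
  isRep : H.IsUnitaryRep mat
  dim_pos : 0 < dim
  irreducible : ∀ T : Matrix (Fin dim) (Fin dim) ℂ, IsIntertwiner mat mat T →
    ∃ c : ℂ, T = c • (1 : Matrix (Fin dim) (Fin dim) ℂ)

variable {H}

/-- Unitary equivalence of irreducible representations. -/
def IrrRep.Equivalent (u v : H.IrrRep) : Prop :=
  ∃ T : Matrix (Fin v.dim) (Fin u.dim) ℂ,
    T.conjTranspose * T = 1 ∧ T * T.conjTranspose = 1 ∧ IsIntertwiner u.mat v.mat T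

lemma scalarMatrix_mul {ι κ μ : Type*} [Fintype κ] (S : Matrix ι κ ℂ) (T : Matrix κ μ ℂ) :
    scalarMatrix A (S * T) = scalarMatrix A S * scalarMatrix A T :=
  Matrix.map_mul

lemma scalarMatrix_one {ι : Type*} [DecidableEq ι] :
    scalarMatrix A (1 : Matrix ι ι ℂ) = 1 :=
  Matrix.map_one _ (map_zero _) (map_one _)

variable (H) in
instance irrSetoid : Setoid H.IrrRep where
  r := IrrRep.Equivalent
  iseqv :=
    { refl := fun u => ⟨1, by simp, by simp, by simp [IsIntertwiner]⟩
      symm := by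
        rintro u v ⟨T, h₁, h₂, h⟩
        refine ⟨T.conjTranspose, by simpa using h₂, by simpa using h₁, ?_⟩
        unfold IsIntertwiner at h ⊢
        calc scalarMatrix A T.conjTranspose * v.mat
            = scalarMatrix A T.conjTranspose * (v.mat * scalarMatrix A T) *
                scalarMatrix A T.conjTranspose := by
              rw [Matrix.mul_assoc, Matrix.mul_assoc, ← scalarMatrix_mul, h₂, scalarMatrix_one,
                Matrix.mul_one]
          _ = u.mat * scalarMatrix A T.conjTranspose := by
              rw [← h, ← Matrix.mul_assoc, ← scalarMatrix_mul, h₁, scalarMatrix_one,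
                Matrix.one_mul]
      trans := by
        rintro u v w ⟨T, h₁, h₂, h⟩ ⟨S, k₁, k₂, k⟩
        refine ⟨S * T, ?_, ?_, ?_⟩
        · rw [Matrix.conjTranspose_mul, Matrix.mul_assoc, ← Matrix.mul_assoc _ S, k₁,
            Matrix.one_mul, h₁]
        · rw [Matrix.conjTranspose_mul, Matrix.mul_assoc, ← Matrix.mul_assoc T, h₂,
            Matrix.one_mul, k₂]
        · unfold IsIntertwiner at h k ⊢
          rw [scalarMatrix_mul, Matrix.mul_assoc, h, ← Matrix.mul_assoc, k, Matrix.mul_assoc] }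

variable (H) in
/-- `Irr(ℍ)`. -/
def Irr : Type _ := Quotient (irrSetoid H)

/-- The class of an irreducible representation. -/
def IrrRep.cls (u : H.IrrRep) : H.Irr := Quotient.mk (irrSetoid H) u

variable (H) in
/-- The trivial representation. -/
def trivialRep : H.IrrRep where
  dim := 1
  mat := 1
  isRep := ⟨one_mem _, fun i j => by
    rw [Subsingleton.elim i 0, Subsingleton.elim j 0]
    simp only [Matrix.one_apply_eq, map_one, Fin.sum_univ_one]
    exact MinTensor.tmul_one.symm⟩
  dim_pos := Nat.one_pos
  irreducible T _ := ⟨T 0 0, by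
    ext i j
    rw [Subsingleton.elim i 0, Subsingleton.elim j 0]
    simp⟩

/-- `v` is conjugate to `u`: it is equivalent to the contragredient `(star (u i j))`. -/
def IrrRep.IsConjugate (u v : H.IrrRep) : Prop :=
  ∃ (S : Matrix (Fin v.dim) (Fin u.dim) ℂ) (S' : Matrix (Fin u.dim) (Fin v.dim) ℂ),
    S * S' = 1 ∧ S' * S = 1 ∧ IsIntertwiner (u.mat.map star) v.mat S

/-- `w` is contained in the tensor product `u × v` (the matrix with entries
`u i j * v k l`): there is an isometric intertwiner. -/
def IrrRep.IsContainedInTensor (w u v : H.IrrRep) : Prop :=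
  ∃ V : Matrix (Fin u.dim × Fin v.dim) (Fin w.dim) ℂ,
    V.conjTranspose * V = 1 ∧ IsIntertwiner w.mat (Matrix.kronecker u.mat v.mat) V

/-- Length functions on the dual `ℍ^`. -/
structure IsLengthFunction (l : H.Irr → ℝ) : Prop where
  nonneg : ∀ x, 0 ≤ l x
  trivial : l H.trivialRep.cls = 0
  conj : ∀ u v : H.IrrRep, u.IsConjugate v → l u.cls = l v.cls
  tensor : ∀ u v w : H.IrrRep, w.IsContainedInTensor u v → l w.cls ≤ l u.cls + l v.cls

variable (H) in
/-- `θ` intertwines the comultiplication: `Δ ∘ θ = (θ ⊗ θ) ∘ Δ`. -/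
def Intertwines (θ : A ≃⋆ₐ[ℂ] A) : Prop :=
  ∃ D : MinTensor A A ≃⋆ₐ[ℂ] MinTensor A A,
    (∀ a b, D (MinTensor.tmul a b) = MinTensor.tmul (θ a) (θ b)) ∧
    ∀ a, H.comul (θ a) = D (H.comul a)

variable (H) in
/-- The automorphism group of the compact quantum group `(C(ℍ), Δ)`. -/
def aut : Subgroup (A ≃⋆ₐ[ℂ] A) where
  carrier := {θ | H.Intertwines θ}
  one_mem' := ⟨1, fun _ _ => rfl, fun _ => rfl⟩
  mul_mem' := by
    rintro θ σ ⟨D, hD, hD'⟩ ⟨E, hE, hE'⟩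
    refine ⟨D * E, fun a b => ?_, fun a => ?_⟩
    · change D (E _) = MinTensor.tmul (θ (σ a)) (θ (σ b))
      rw [hE, hD]
    · change H.comul (θ (σ a)) = D (E _)
      rw [hD', hE']
  inv_mem' := by
    rintro θ ⟨D, hD, hD'⟩
    refine ⟨D.symm, fun a b => ?_, fun a => ?_⟩
    · change D.symm _ = MinTensor.tmul (θ.symm a) (θ.symm b)
      rw [← D.symm_apply_apply (MinTensor.tmul (θ.symm a) (θ.symm b)), hD, θ.apply_symm_apply,
        θ.apply_symm_apply]
    · change H.comul (θ.symm a) = D.symm _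
      rw [← D.symm_apply_apply (H.comul (θ.symm a)), ← hD', θ.apply_symm_apply]

lemma scalarMatrix_map (θ : A ≃⋆ₐ[ℂ] A) {ι κ : Type*} (T : Matrix κ ι ℂ) :
    (scalarMatrix A T).map θ = scalarMatrix A T := by
  ext i j
  simp [scalarMatrix, Algebra.algebraMap_eq_smul_one]

lemma isIntertwiner_map (θ : A ≃⋆ₐ[ℂ] A) {ι κ : Type*} [Fintype ι] [Fintype κ]
    {u : Matrix ι ι A} {v : Matrix κ κ A} {T : Matrix κ ι ℂ} (h : IsIntertwiner u v T) :
    IsIntertwiner (u.map θ) (v.map θ) T := by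
  have := congrArg (fun M : Matrix κ ι A => M.map θ) h
  simpa only [Matrix.map_mul, scalarMatrix_map, IsIntertwiner] using this

/-- `θ_*(u) = (id ⊗ θ)(u)`. -/
def IrrRep.map (θ : H.aut) (u : H.IrrRep) : H.IrrRep where
  dim := u.dim
  mat := u.mat.map (θ : A ≃⋆ₐ[ℂ] A)
  isRep := by
    obtain ⟨θ, D, hD, hD'⟩ := θ
    obtain ⟨⟨h₁, h₂⟩, h₃⟩ := u.isRep
    have hs : star (u.mat.map θ) = (star u.mat).map θ := by
      ext i j
      simp [Matrix.star_apply, map_star]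
    refine ⟨⟨?_, ?_⟩, fun i j => ?_⟩
    · rw [hs, ← Matrix.map_mul, h₁]
      exact Matrix.map_one _ (map_zero _) (map_one _)
    · rw [hs, ← Matrix.map_mul, h₂]
      exact Matrix.map_one _ (map_zero _) (map_one _)
    · simp only [Matrix.map_apply, hD', h₃, map_sum, hD]
  dim_pos := u.dim_pos
  irreducible T hT := u.irreducible T <| by
    have := isIntertwiner_map (θ : A ≃⋆ₐ[ℂ] A).symm hT
    simpa [Matrix.map_map, Function.comp_def] using this

/-- The induced map `θ_* [u] = [θ_*(u)]` on `Irr(ℍ)`. -/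
def irrMap (θ : H.aut) : H.Irr → H.Irr :=
  Quotient.map (IrrRep.map θ) fun _ _ ⟨T, h₁, h₂, h⟩ =>
    ⟨T, h₁, h₂, isIntertwiner_map (θ : A ≃⋆ₐ[ℂ] A) h⟩

/-- `l` is invariant under a group `Θ` of automorphisms. -/
def IsInvariant (Θ : Subgroup H.aut) (l : H.Irr → ℝ) : Prop :=
  ∀ θ ∈ Θ, ∀ x, l (irrMap θ x) = l x

/-- The average `|Θ|⁻¹ ∑ l ∘ θ_*` of `l` over a finite group `Θ` of automorphisms. -/
def average (Θ : Subgroup H.aut) [Fintype Θ] (l : H.Irr → ℝ) : H.Irr → ℝ :=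
  fun x => (Fintype.card Θ : ℝ)⁻¹ * ∑ θ : Θ, l (irrMap θ.1 x)

variable (H) in
/-- A choice of a representation `u^x` in every class `x ∈ Irr(ℍ)`. -/
structure Representatives where
  rep : H.Irr → H.IrrRep
  cls_rep : ∀ x, (rep x).cls = x

namespace Representatives

variable (R : H.Representatives)

/-- `c_c(ℍ^)`, the algebraic direct sum of the full matrix algebras `B(H_x)`, where
`H_x = ℂ^(dim x)` is the space of `u^x`. -/
abbrev Cc : Type _ :=
  Π₀ x : H.Irr, Matrix (Fin (R.rep x).dim) (Fin (R.rep x).dim) ℂ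

open Classical in
/-- The Fourier transform `∑ x, (dim x) (Tr ⊗ id)(u^x (a p_x ⊗ 1))`. -/
def fourier (a : R.Cc) : A :=
  a.sum fun x m => ((R.rep x).dim : ℂ) • Matrix.trace ((R.rep x).mat * scalarMatrix A m)

open Classical in
/-- The Sobolev-0-norm, `‖a‖₀² = ∑ x, (dim x) Tr(a* a p_x)`. -/
def sobolevNorm (a : R.Cc) : ℝ :=
  Real.sqrt (a.sum fun x m =>
    ((R.rep x).dim : ℝ) * (Matrix.trace (m.conjTranspose * m)).re)

open Classical in
/-- Multiplication by the central projection `Q_{l,k} = ∑ p_x` over all `x` with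
`l x < k + 1`, on `c_c(ℍ^)`. -/
def cutoff (l : H.Irr → ℝ) (k : ℕ) (a : R.Cc) : R.Cc :=
  a.filter fun x => l x < k + 1

/-- `‖F(a)‖ ≤ P(k) ‖a‖₀` for all `k` and all `a ∈ Q_{l,k} c_c(ℍ^)`. -/
def RapidDecayBound (l : H.Irr → ℝ) (P : Polynomial ℝ) : Prop :=
  ∀ k : ℕ, ∀ a ∈ Set.range (R.cutoff l k),
    ‖R.fourier a‖ ≤ P.eval (k : ℝ) * R.sobolevNorm a

end Representatives

end CompactQuantumGroup

end

/-!
If the average of `l ∘ θ_*` over `θ ∈ Θ` is less than `k + 1` at `x`, then so is one of its terms.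
So an element of `c_c(ℍ^)` supported on the average's ball of radius `k + 1` splits into `|Θ|`
orthogonal pieces, the `θ`-th one supported on a ball of `l ∘ θ_*`. Each `l ∘ θ_*` satisfies (RD)
with the same polynomial as `l`, since `θ` acts isometrically on `C(ℍ)` and on `c_c(ℍ^)`.
Cauchy–Schwarz for the `|Θ|` norms `‖·‖₀` of the pieces produces the factor `√|Θ|`.
-/

section FinitelySupported

variable {ι κ M : Type*} {β : ι → Type*} [DecidableEq ι] [∀ i, Zero (β i)]
  [∀ i (m : β i), Decidable (m ≠ 0)] [AddCommMonoid M]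

lemma dfinsupp_sum_equivCongrLeft [DecidableEq κ] (e : ι ≃ κ) (a : Π₀ i, β i)
    (h : ∀ i, β i → M) :
    ((DFinsupp.equivCongrLeft e a).sum fun k m => h (e.symm k) m) = a.sum h :=
  Finset.sum_equiv e.symm
    (fun k => by simp [DFinsupp.equivCongrLeft]) fun _ _ => rfl

lemma dfinsupp_sum_filter_fiberwise [Fintype κ] [DecidableEq κ] (g : ι → κ) (a : Π₀ i, β i)
    (h : ∀ i, β i → M) :
    ∑ j, (a.filter (g · = j)).sum h = a.sum h := by
  simp only [DFinsupp.sum, DFinsupp.support_filter]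
  rw [← Finset.sum_fiberwise a.support g]
  refine Finset.sum_congr rfl fun j _ => Finset.sum_congr rfl fun i hi => ?_
  rw [DFinsupp.filter_apply, if_pos (Finset.mem_filter.1 hi).2]

end FinitelySupported

section Trace

variable {ι κ : Type*} [Fintype ι] [Fintype κ]

lemma trace_map_algebraMap_mul_comm {R A : Type*} [CommSemiring R] [Semiring A] [Algebra R A]
    (T : Matrix κ ι R) (M : Matrix ι κ A) :
    (T.map (algebraMap R A) * M).trace = (M * T.map (algebraMap R A)).trace := by
  -- `Matrix.trace_mul_comm` is only available over commutative coefficients, and `A` is not.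
  simp only [Matrix.trace, Matrix.diag_apply, Matrix.mul_apply, Matrix.map_apply]
  rw [Finset.sum_comm]
  exact Finset.sum_congr rfl fun i _ => Finset.sum_congr rfl fun j _ => Algebra.commutes _ _

open scoped Matrix in
lemma trace_conjTranspose_mul_self_conj {R : Type*} [CommSemiring R] [StarRing R] [DecidableEq ι]
    {T : Matrix κ ι R} (hT : Tᴴ * T = 1) (m : Matrix ι ι R) :
    ((T * m * Tᴴ)ᴴ * (T * m * Tᴴ)).trace = (mᴴ * m).trace :=
  calc ((T * m * Tᴴ)ᴴ * (T * m * Tᴴ)).trace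
      = (T * (mᴴ * (Tᴴ * T) * m * Tᴴ)).trace := by
        simp only [Matrix.conjTranspose_mul, Matrix.conjTranspose_conjTranspose, Matrix.mul_assoc]
    _ = (mᴴ * m * (Tᴴ * T)).trace := by
        rw [hT, Matrix.mul_one, Matrix.trace_mul_comm, Matrix.mul_assoc, hT]
    _ = (mᴴ * m).trace := by rw [hT, Matrix.mul_one]

open scoped ComplexOrder in
lemma trace_conjTranspose_mul_self_re_nonneg (m : Matrix κ ι ℂ) :
    0 ≤ (m.conjTranspose * m).trace.re :=
  (Complex.le_def.1 (Matrix.posSemidef_conjTranspose_mul_self m).trace_nonneg).1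

end Trace

namespace CompactQuantumGroup

variable {A : Type*} [CStarAlgebra A] {H : CompactQuantumGroup A}

lemma trace_mul_scalarMatrix_conj {ι κ : Type*} [Fintype ι] [DecidableEq ι] [Fintype κ]
    {u : Matrix ι ι A} {v : Matrix κ κ A} {T : Matrix κ ι ℂ}
    (hT : T.conjTranspose * T = 1) (h : IsIntertwiner u v T) (m : Matrix ι ι ℂ) :
    (v * scalarMatrix A (T * m * T.conjTranspose)).trace = (u * scalarMatrix A m).trace :=
  calc (v * scalarMatrix A (T * m * T.conjTranspose)).trace
      = (v * scalarMatrix A T * scalarMatrix A (m * T.conjTranspose)).trace := by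
        rw [Matrix.mul_assoc T, scalarMatrix_mul, Matrix.mul_assoc]
    _ = (scalarMatrix A T * (u * scalarMatrix A (m * T.conjTranspose))).trace := by
        rw [← h, Matrix.mul_assoc]
    _ = (u * scalarMatrix A (m * T.conjTranspose * T)).trace := by
        rw [trace_map_algebraMap_mul_comm, scalarMatrix_mul (m * _), Matrix.mul_assoc]
    _ = (u * scalarMatrix A m).trace := by rw [Matrix.mul_assoc m, hT, Matrix.mul_one]

lemma IrrRep.Equivalent.dim_eq {u v : H.IrrRep} (h : u.Equivalent v) : u.dim = v.dim := by
  obtain ⟨T, h₁, h₂, -⟩ := h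
  have htrace := Matrix.trace_mul_comm T.conjTranspose T
  rw [h₁, h₂] at htrace
  simpa using htrace

/-- The action `θ • x = θ_* x` of the automorphism group of `ℍ` on `Irr(ℍ)`. -/
instance : MulAction H.aut H.Irr where
  smul := irrMap
  one_smul := Quotient.ind fun _ => rfl
  mul_smul _ _ := Quotient.ind fun _ => rfl

lemma irrMap_eq_smul (θ : H.aut) (x : H.Irr) : irrMap θ x = θ • x := rfl

lemma smul_cls (θ : H.aut) (u : H.IrrRep) : θ • u.cls = (u.map θ).cls := rfl

lemma smul_cls_trivialRep (θ : H.aut) : θ • H.trivialRep.cls = H.trivialRep.cls := by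
  have hmap : (1 : Matrix (Fin 1) (Fin 1) A).map (θ : A ≃⋆ₐ[ℂ] A) = 1 :=
    Matrix.map_one _ (map_zero _) (map_one _)
  simp only [smul_cls, IrrRep.map, trivialRep, hmap]

lemma IrrRep.IsConjugate.map (θ : H.aut) {u v : H.IrrRep} (h : u.IsConjugate v) :
    (u.map θ).IsConjugate (v.map θ) := by
  obtain ⟨S, S', h₁, h₂, hS⟩ := h
  have hstar : (u.map θ).mat.map star = (u.mat.map star).map (θ : A ≃⋆ₐ[ℂ] A) := by
    ext i j
    exact (map_star (θ : A ≃⋆ₐ[ℂ] A) (u.mat i j)).symm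
  exact ⟨S, S', h₁, h₂, hstar ▸ isIntertwiner_map _ hS⟩

lemma IrrRep.IsContainedInTensor.map (θ : H.aut) {u v w : H.IrrRep}
    (h : w.IsContainedInTensor u v) :
    (w.map θ).IsContainedInTensor (u.map θ) (v.map θ) := by
  obtain ⟨V, h₁, hV⟩ := h
  have hkronecker : Matrix.kronecker (u.map θ).mat (v.map θ).mat =
      (Matrix.kronecker u.mat v.mat).map (θ : A ≃⋆ₐ[ℂ] A) := by
    ext i j
    exact (map_mul (θ : A ≃⋆ₐ[ℂ] A) (u.mat i.1 j.1) (v.mat i.2 j.2)).symm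
  exact ⟨V, h₁, hkronecker ▸ isIntertwiner_map _ hV⟩

namespace IsLengthFunction

lemma comp_smul {l : H.Irr → ℝ} (hl : IsLengthFunction l) (θ : H.aut) :
    IsLengthFunction fun x => l (θ • x) where
  nonneg _ := hl.nonneg _
  trivial := by rw [smul_cls_trivialRep, hl.trivial]
  conj _ _ h := hl.conj _ _ (h.map θ)
  tensor _ _ _ h := hl.tensor _ _ _ (h.map θ)

lemma sum {ι : Type*} {s : Finset ι} {l : ι → H.Irr → ℝ}
    (hl : ∀ i ∈ s, IsLengthFunction (l i)) : IsLengthFunction fun x => ∑ i ∈ s, l i x where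
  nonneg x := Finset.sum_nonneg fun i hi => (hl i hi).nonneg x
  trivial := Finset.sum_eq_zero fun i hi => (hl i hi).trivial
  conj u v h := Finset.sum_congr rfl fun i hi => (hl i hi).conj u v h
  tensor u v w h := by
    rw [← Finset.sum_add_distrib]
    exact Finset.sum_le_sum fun i hi => (hl i hi).tensor u v w h

lemma const_mul {l : H.Irr → ℝ} (hl : IsLengthFunction l) {c : ℝ} (hc : 0 ≤ c) :
    IsLengthFunction fun x => c * l x where
  nonneg x := mul_nonneg hc (hl.nonneg x)
  trivial := by rw [hl.trivial, mul_zero]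
  conj u v h := by rw [hl.conj u v h]
  tensor u v w h := by
    rw [← mul_add]
    exact mul_le_mul_of_nonneg_left (hl.tensor u v w h) hc

lemma average {l : H.Irr → ℝ} (hl : IsLengthFunction l) (Θ : Subgroup H.aut) [Fintype Θ] :
    IsLengthFunction (average Θ l) :=
  (IsLengthFunction.sum fun (θ : Θ) _ => hl.comp_smul θ.1).const_mul (by positivity)

end IsLengthFunction

section Average

variable (Θ : Subgroup H.aut) [Fintype Θ] (l : H.Irr → ℝ)

lemma isInvariant_average : IsInvariant Θ (average Θ l) := by
  intro θ hθ x
  simp only [average, irrMap_eq_smul]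
  congr 1
  refine Fintype.sum_equiv (Equiv.mulRight (⟨θ, hθ⟩ : Θ)) _ _ fun σ => ?_
  exact congrArg l (mul_smul σ.1 θ x).symm

lemma exists_le_average (x : H.Irr) : ∃ θ : Θ, l (θ.1 • x) ≤ average Θ l x := by
  have hsum : ∑ θ : Θ, l (θ.1 • x) ≤ ∑ _θ : Θ, average Θ l x := by
    simp [average, irrMap_eq_smul]
  obtain ⟨θ, -, hθ⟩ := Finset.exists_le_of_sum_le Finset.univ_nonempty hsum
  exact ⟨θ, hθ⟩

end Average

namespace Representatives

variable (R : H.Representatives)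

lemma fourier_zero : R.fourier 0 = 0 := by
  classical
  exact DFinsupp.sum_zero_index

lemma sobolevNorm_zero : R.sobolevNorm 0 = 0 := by
  classical
  rw [sobolevNorm, DFinsupp.sum_zero_index, Real.sqrt_zero]

lemma sobolevNorm_nonneg (a : R.Cc) : 0 ≤ R.sobolevNorm a := Real.sqrt_nonneg _

open Classical in
lemma sobolevNorm_sq (a : R.Cc) :
    R.sobolevNorm a ^ 2 =
      a.sum fun x m => ((R.rep x).dim : ℝ) * (m.conjTranspose * m).trace.re :=
  Real.sq_sqrt <| Finset.sum_nonneg fun _ _ =>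
    mul_nonneg (Nat.cast_nonneg _) (trace_conjTranspose_mul_self_re_nonneg _)

open Classical in
lemma sobolevNorm_single_one (x : H.Irr) :
    R.sobolevNorm (DFinsupp.single x 1) = (R.rep x).dim := by
  rw [sobolevNorm, DFinsupp.sum_single_index (by simp)]
  simp

section Fiberwise

variable {κ : Type*} [Fintype κ] [DecidableEq κ] (g : H.Irr → κ) (a : R.Cc)

lemma sum_fourier_filter : ∑ j, R.fourier (a.filter (g · = j)) = R.fourier a := by
  classical
  exact dfinsupp_sum_filter_fiberwise g a _

lemma sum_sobolevNorm_filter_sq :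
    ∑ j, R.sobolevNorm (a.filter (g · = j)) ^ 2 = R.sobolevNorm a ^ 2 := by
  classical
  simp only [sobolevNorm_sq]
  exact dfinsupp_sum_filter_fiberwise g a _

lemma sum_sobolevNorm_filter_le :
    ∑ j, R.sobolevNorm (a.filter (g · = j)) ≤ √(Fintype.card κ) * R.sobolevNorm a := by
  refine le_of_sq_le_sq ?_ (mul_nonneg (Real.sqrt_nonneg _) (R.sobolevNorm_nonneg a))
  rw [mul_pow, Real.sq_sqrt (Nat.cast_nonneg _), ← R.sum_sobolevNorm_filter_sq g a]
  exact sq_sum_le_card_mul_sum_sq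

end Fiberwise

lemma mem_range_cutoff_iff {l : H.Irr → ℝ} {k : ℕ} {a : R.Cc} :
    a ∈ Set.range (R.cutoff l k) ↔ ∀ x, a x ≠ 0 → l x < k + 1 := by
  classical
  constructor
  · rintro ⟨b, rfl⟩ x hx
    by_contra hlx
    exact hx (DFinsupp.filter_apply_neg b hlx)
  · refine fun h => ⟨a, DFinsupp.ext fun x => ?_⟩
    by_cases hlx : l x < k + 1
    · exact DFinsupp.filter_apply_pos a hlx
    · rw [not_imp_comm.1 (h x) hlx]
      exact DFinsupp.filter_apply_neg a hlx

section ChangeOfRepresentatives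

variable (R' : H.Representatives)

lemma rep_equivalent_rep (x : H.Irr) : (R.rep x).Equivalent (R'.rep x) :=
  Quotient.exact ((R.cls_rep x).trans (R'.cls_rep x).symm)

lemma exists_fourier_eq_of_representatives (a : R.Cc) :
    ∃ b : R'.Cc, R'.fourier b = R.fourier a ∧ R'.sobolevNorm b = R.sobolevNorm a ∧
      ∀ x, b x ≠ 0 → a x ≠ 0 := by
  classical
  have hdim (x : H.Irr) : (R'.rep x).dim = (R.rep x).dim :=
    (R.rep_equivalent_rep R' x).dim_eq.symm
  choose T hT _ hint using R.rep_equivalent_rep R'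
  let conj (x : H.Irr) (m : Matrix (Fin (R.rep x).dim) (Fin (R.rep x).dim) ℂ) :=
    T x * m * (T x).conjTranspose
  have conj_zero (x : H.Irr) : conj x 0 = 0 := by simp [conj]
  refine ⟨a.mapRange conj conj_zero, ?_, ?_, fun x hx ha => hx ?_⟩
  · rw [fourier, DFinsupp.sum_mapRange_index fun x => by simp [scalarMatrix]]
    simp only [conj, hdim, trace_mul_scalarMatrix_conj (hT _) (hint _), fourier]
  · rw [sobolevNorm, DFinsupp.sum_mapRange_index fun x => by simp]
    simp only [conj, hdim, trace_conjTranspose_mul_self_conj (hT _), sobolevNorm]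
  · rw [DFinsupp.mapRange_apply, ha, conj_zero]

end ChangeOfRepresentatives

section Relabelling

variable (θ : H.aut)

/-- The image of a choice of representatives under an automorphism: the class `y` is represented
by `θ_*(u^x)`, where `x = θ⁻¹ • y`. -/
def map : H.Representatives where
  rep y := (R.rep (θ⁻¹ • y)).map θ
  cls_rep y := by rw [← smul_cls, R.cls_rep, smul_inv_smul]

/-- The bijection from `c_c(ℍ^)` to itself that moves the block `x` to the block `θ • x`, with
matrices unchanged because `θ_*(u^x)` acts on the same space as `u^x`. -/
def relabel : R.Cc ≃ (R.map θ).Cc := DFinsupp.equivCongrLeft (MulAction.toPerm θ)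

lemma fourier_relabel (a : R.Cc) :
    (R.map θ).fourier (R.relabel θ a) = (θ : A ≃⋆ₐ[ℂ] A) (R.fourier a) := by
  classical
  have hblock (x : H.Irr) (m : Matrix (Fin (R.rep x).dim) (Fin (R.rep x).dim) ℂ) :
      ((R.rep x).mat.map (θ : A ≃⋆ₐ[ℂ] A) * scalarMatrix A m).trace =
        (θ : A ≃⋆ₐ[ℂ] A) ((R.rep x).mat * scalarMatrix A m).trace := by
    rw [AddMonoidHom.map_trace, Matrix.map_mul, scalarMatrix_map]
  refine (dfinsupp_sum_equivCongrLeft (MulAction.toPerm θ) a fun x m => ((R.rep x).dim : ℂ) •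
    ((R.rep x).mat.map (θ : A ≃⋆ₐ[ℂ] A) * scalarMatrix A m).trace).trans ?_
  simp only [hblock, fourier, DFinsupp.sum, map_sum, map_smul]

lemma sobolevNorm_relabel (a : R.Cc) :
    (R.map θ).sobolevNorm (R.relabel θ a) = R.sobolevNorm a := by
  classical
  exact congrArg Real.sqrt <| dfinsupp_sum_equivCongrLeft (MulAction.toPerm θ) a fun x m =>
    ((R.rep x).dim : ℝ) * (m.conjTranspose * m).trace.re

end Relabelling

namespace RapidDecayBound

variable {R} {l : H.Irr → ℝ} {P : Polynomial ℝ}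

lemma eval_nonneg (hP : R.RapidDecayBound l P) {x : H.Irr} {k : ℕ} (hx : l x < k + 1) :
    0 ≤ P.eval (k : ℝ) := by
  classical
  have hmem : DFinsupp.single x 1 ∈ Set.range (R.cutoff l k) :=
    ⟨DFinsupp.single x 1, DFinsupp.filter_single_pos x 1 hx⟩
  have hbound := (norm_nonneg _).trans (hP k _ hmem)
  rw [sobolevNorm_single_one] at hbound
  exact nonneg_of_mul_nonneg_left hbound (Nat.cast_pos.2 (R.rep x).dim_pos)

lemma of_representatives (hP : R.RapidDecayBound l P) (R' : H.Representatives) :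
    R'.RapidDecayBound l P := by
  intro k a ha
  obtain ⟨b, hfourier, hnorm, hsupp⟩ := R'.exists_fourier_eq_of_representatives R a
  rw [← hfourier, ← hnorm]
  exact hP k b (R.mem_range_cutoff_iff.2 fun x hx => R'.mem_range_cutoff_iff.1 ha x (hsupp x hx))

lemma comp_smul (hP : R.RapidDecayBound l P) (θ : H.aut) :
    R.RapidDecayBound (fun x => l (θ • x)) P := by
  intro k a ha
  have hmem : R.relabel θ a ∈ Set.range ((R.map θ).cutoff l k) :=
    (R.map θ).mem_range_cutoff_iff.2 fun y hy => by
      simpa only [smul_inv_smul] using R.mem_range_cutoff_iff.1 ha (θ⁻¹ • y) hy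
  calc ‖R.fourier a‖
      = ‖(R.map θ).fourier (R.relabel θ a)‖ := by
        rw [fourier_relabel, NonUnitalStarAlgHom.norm_map (θ : A ≃⋆ₐ[ℂ] A) θ.1.injective]
    _ ≤ P.eval (k : ℝ) * (R.map θ).sobolevNorm (R.relabel θ a) :=
        hP.of_representatives (R.map θ) k _ hmem
    _ = P.eval (k : ℝ) * R.sobolevNorm a := by rw [sobolevNorm_relabel]

lemma of_exists_le {ι : Type*} [Fintype ι] {l : ι → H.Irr → ℝ} {L : H.Irr → ℝ}
    (hl : ∀ i, R.RapidDecayBound (l i) P) (hL : ∀ x, ∃ i, l i x ≤ L x) :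
    R.RapidDecayBound L (Polynomial.C √(Fintype.card ι) * P) := by
  classical
  intro k a ha
  rw [mem_range_cutoff_iff] at ha
  obtain rfl | ha_ne := eq_or_ne a 0
  · simp [fourier_zero, sobolevNorm_zero]
  choose i hi using hL
  obtain ⟨x, hx⟩ := DFinsupp.ne_iff.1 ha_ne
  have hP : 0 ≤ P.eval (k : ℝ) := (hl (i x)).eval_nonneg ((hi x).trans_lt (ha x hx))
  have hpiece (j : ι) : ‖R.fourier (a.filter (i · = j))‖ ≤
      P.eval (k : ℝ) * R.sobolevNorm (a.filter (i · = j)) := by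
    refine hl j k _ (R.mem_range_cutoff_iff.2 fun y hy => ?_)
    obtain ⟨rfl, hay⟩ : i y = j ∧ a y ≠ 0 := by simpa [DFinsupp.filter_apply] using hy
    exact (hi y).trans_lt (ha y hay)
  calc ‖R.fourier a‖
      ≤ ∑ j, ‖R.fourier (a.filter (i · = j))‖ := by
        rw [← R.sum_fourier_filter i a]
        exact norm_sum_le _ _
    _ ≤ P.eval (k : ℝ) * ∑ j, R.sobolevNorm (a.filter (i · = j)) := by
        rw [Finset.mul_sum]
        exact Finset.sum_le_sum fun j _ => hpiece j
    _ ≤ P.eval (k : ℝ) * (√(Fintype.card ι) * R.sobolevNorm a) :=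
        mul_le_mul_of_nonneg_left (R.sum_sobolevNorm_filter_le i a) hP
    _ = (Polynomial.C √(Fintype.card ι) * P).eval (k : ℝ) * R.sobolevNorm a := by
        rw [Polynomial.eval_mul, Polynomial.eval_C]
        ring

lemma average (hP : R.RapidDecayBound l P) (Θ : Subgroup H.aut) [Fintype Θ] :
    R.RapidDecayBound (average Θ l) (Polynomial.C √(Fintype.card Θ) * P) :=
  of_exists_le (fun θ : Θ => hP.comp_smul θ.1) (exists_le_average Θ l)

end RapidDecayBound

end Representatives

end CompactQuantumGroup

theorem mainTheorem6_general {A : Type*} [CStarAlgebra A] (H : CompactQuantumGroup A)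
    (R : H.Representatives) (Θ : Subgroup H.aut) [Fintype Θ] :
    ((∃ (l : H.Irr → ℝ) (P : Polynomial ℝ),
        CompactQuantumGroup.IsLengthFunction l ∧ R.RapidDecayBound l P) ↔
      ∃ (l : H.Irr → ℝ) (Q : Polynomial ℝ),
        CompactQuantumGroup.IsLengthFunction l ∧ CompactQuantumGroup.IsInvariant Θ l ∧
          R.RapidDecayBound l Q) ∧
    ∀ (l : H.Irr → ℝ) (P : Polynomial ℝ),
      CompactQuantumGroup.IsLengthFunction l → R.RapidDecayBound l P →
        CompactQuantumGroup.IsLengthFunction (CompactQuantumGroup.average Θ l) ∧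
        CompactQuantumGroup.IsInvariant Θ (CompactQuantumGroup.average Θ l) ∧
        R.RapidDecayBound (CompactQuantumGroup.average Θ l)
          (Polynomial.C (Real.sqrt (Fintype.card Θ)) * P) := by
  refine ⟨⟨?_, ?_⟩, fun l P hl hP => ?_⟩
  · rintro ⟨l, P, hl, hP⟩
    exact ⟨_, _, hl.average Θ, CompactQuantumGroup.isInvariant_average Θ l, hP.average Θ⟩
  · rintro ⟨l, Q, hl, -, hQ⟩
    exact ⟨l, Q, hl, hQ⟩
  · exact ⟨hl.average Θ, CompactQuantumGroup.isInvariant_average Θ l, hP.average Θ⟩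

theorem mainTheorem6 {A : Type*} [CStarAlgebra A] (H : CompactQuantumGroup A) (hKac : H.IsKac)
    (R : H.Representatives) (Θ : Subgroup H.aut) [Fintype Θ] :
    ((∃ (l : H.Irr → ℝ) (P : Polynomial ℝ),
        CompactQuantumGroup.IsLengthFunction l ∧ R.RapidDecayBound l P) ↔
      ∃ (l : H.Irr → ℝ) (Q : Polynomial ℝ),
        CompactQuantumGroup.IsLengthFunction l ∧ CompactQuantumGroup.IsInvariant Θ l ∧
          R.RapidDecayBound l Q) ∧
    ∀ (l : H.Irr → ℝ) (P : Polynomial ℝ),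
      CompactQuantumGroup.IsLengthFunction l → R.RapidDecayBound l P →
        CompactQuantumGroup.IsLengthFunction (CompactQuantumGroup.average Θ l) ∧
        CompactQuantumGroup.IsInvariant Θ (CompactQuantumGroup.average Θ l) ∧
        R.RapidDecayBound (CompactQuantumGroup.average Θ l)
          (Polynomial.C (Real.sqrt (Fintype.card Θ)) * P) :=
  mainTheorem6_general H R Θ
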